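/- Let $r,s\ge 0$ and $n,\lambda\ge 1$ be integers with $\max\{r,s\}\le n$. An $r\times s$ $\lambda$-Latin rectangle (on the symbol set $[n]=\{1,\dots,n\}$) is an $r\times s$ array in which each cell contains a multiset of exactly $\lambda$ symbols from $[n]$, such that every symbol occurs at most $\lambda$ times in each row and at most $\lambda$ times in each column, counted with multiplicity (so every symbol occurs at most $\lambda n$ times in total). An $n\times n$ $\lambda$-Latin square is an $n\times n$ $\lambda$-Latin rectangle; in it every symbol occurs exactly $\lambda n$ times. Such an array is simple if no symbol is repeated in any cell. An $n\times n$ array extends an $r\times s$ array $M$ if its top left $r\times s$ corner is $M$. For a symbol $\ell\in[n]$, a row $i$ and a column $j$, let $|M_\ell|$, $|M^i_\ell|$ and $|{}^jM_\ell|$ denote the number of occurrences of $\ell$ in $M$, in row $i$ of $M$, and in column $j$ of $M$, respectively. Let $M$ be a simple $r\times s$ $\lambda$-Latin rectangle. Then $M$ can be extended to a simple $n\times n$ $\lambda$-Latin square if and only if all of the following hold: - $\lambda\le n$; - $\lambda(r+s-n)\le |M_\ell|\le \lambda(r+s-n)+(n-r)(n-s)$ for every $\ell\in[n]$; - $|M^i_\ell|\ge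 \lambda+s-n$ for every $i\in[r]$ and $\ell\in[n]$; - $|{}^jM_\ell|\ge \lambda+r-n$ for every $j\in[s]$ and $\ell\in[n]$. -/

import Mathlib

open Finset

/-- An `r × s` array whose cells hold multisets of symbols from a `k`-element set. -/
abbrev MultiArray (r s k : ℕ) : Type := Fin r → Fin s → Multiset (Fin k)

namespace MultiArray

variable {r s k : ℕ}

/-- The number of occurrences of the symbol `ℓ` in the cell in row `i` and column `j`. -/
def cellCount (M : MultiArray r s k) (i : Fin r) (j : Fin s) (ℓ : Fin k) : ℕ :=
  (M i j).count ℓ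

/-- The number of occurrences of the symbol `ℓ` in row `i`. -/
def rowCount (M : MultiArray r s k) (i : Fin r) (ℓ : Fin k) : ℕ :=
  ∑ j, M.cellCount i j ℓ

/-- The number of occurrences of the symbol `ℓ` in column `j`. -/
def colCount (M : MultiArray r s k) (j : Fin s) (ℓ : Fin k) : ℕ :=
  ∑ i, M.cellCount i j ℓ

/-- The number of occurrences of the symbol `ℓ` in the whole array. -/
def symbolCount (M : MultiArray r s k) (ℓ : Fin k) : ℕ :=
  ∑ i, ∑ j, M.cellCount i j ℓ

/-- A `lam`-matrix: every cell holds exactly `lam` symbols, counted with multiplicity. -/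
def IsLamMatrix (lam : ℕ) (M : MultiArray r s k) : Prop :=
  ∀ i j, (M i j).card = lam

/-- An `r × s` `(ρ, lam)`-Latin rectangle. -/
structure IsRhoLatinRectangle (ρ : Fin k → ℕ) (lam : ℕ) (M : MultiArray r s k) : Prop where
  isLamMatrix : M.IsLamMatrix lam
  symbolCount_le : ∀ ℓ, M.symbolCount ℓ ≤ ρ ℓ
  rowCount_le : ∀ i ℓ, M.rowCount i ℓ ≤ lam
  colCount_le : ∀ j ℓ, M.colCount j ℓ ≤ lam

/-- An `n × n` `(ρ, lam)`-Latin square. -/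
structure IsRhoLatinSquare {n : ℕ} (ρ : Fin k → ℕ) (lam : ℕ) (M : MultiArray n n k) : Prop where
  isLamMatrix : M.IsLamMatrix lam
  symbolCount_eq : ∀ ℓ, M.symbolCount ℓ = ρ ℓ
  rowCount_le : ∀ i ℓ, M.rowCount i ℓ ≤ lam
  colCount_le : ∀ j ℓ, M.colCount j ℓ ≤ lam

/-- An `r × s` `lam`-Latin rectangle on `n` symbols: `ρ = (lam n, …, lam n)`. -/
def IsLatinRectangle {n : ℕ} (lam : ℕ) (M : MultiArray r s n) : Prop :=
  M.IsRhoLatinRectangle (fun _ => lam * n) lam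

/-- An `n × n` `lam`-Latin square on `n` symbols: `ρ = (lam n, …, lam n)`. -/
def IsLatinSquare {n : ℕ} (lam : ℕ) (N : MultiArray n n n) : Prop :=
  N.IsRhoLatinSquare (fun _ => lam * n) lam

/-- No symbol is repeated in any cell. -/
def IsSimple (M : MultiArray r s k) : Prop :=
  ∀ i j ℓ, M.cellCount i j ℓ ≤ 1

/-- `N` extends `M`: the top left `r × s` corner of `N` is `M`. -/
def Extends {n : ℕ} (hr : r ≤ n) (hs : s ≤ n) (N : MultiArray n n k) (M : MultiArray r s k) :
    Prop :=
  ∀ i j, N (Fin.castLE hr i) (Fin.castLE hs j) = M i j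

end MultiArray

/-! View a simple array as a zero-one array in row, column and symbol. Necessity is counting in the
four blocks of the square. For sufficiency, merge the new rows into one row and the new columns into
one column. The counts of `M` then force every amalgamated entry: in new columns, row `i` needs `lam
- |M^i_ℓ|` copies of `ℓ`, and the corner needs `|M_ℓ| - lam(r+s-n)`. The stated inequalities say
exactly that these numbers lie between 0 and the number of cells merged. The merging is undone by
`exists_matrix_split`, once for the columns and once for the rows. It divides an integer matrix
evenly into `k` integer matrices, peeling off one at a time: the matrix divided by `k` is a real
point of a transportation polytope with integer data, and such a polytope has an integer point. -/

/-! ### Integer points of transportation polytopes -/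

/-- If every nonempty row and every nonempty column of a nonempty set `F` of cells has at least
two cells, then `F` supports a nonzero matrix with vanishing row and column sums. -/
theorem exists_ne_zero_margins_zero {ι κ : Type*} [Fintype ι] [Fintype κ] [DecidableEq ι]
    [DecidableEq κ] (F : Finset (ι × κ)) (hF : F.Nonempty)
    (hrow : ∀ p ∈ F, ∃ q ∈ F, q ≠ p ∧ q.1 = p.1) (hcol : ∀ p ∈ F, ∃ q ∈ F, q ≠ p ∧ q.2 = p.2) :
    ∃ z : ι × κ → ℝ, z ≠ 0 ∧ (∀ p ∉ F, z p = 0) ∧ (∀ i, ∑ j, z (i, j) = 0) ∧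
      ∀ j, ∑ i, z (i, j) = 0 := by
  obtain ⟨p₀, hp₀⟩ := hF
  have hP : 2 * #(F.image Prod.fst) ≤ #F := by
    refine mul_card_image_le_card F 2 fun a ha => ?_
    obtain ⟨p, hp, rfl⟩ := mem_image.1 ha
    obtain ⟨q, hq, hne, hqp⟩ := hrow p hp
    exact one_lt_card.2 ⟨q, by simp [hq, hqp], p, by simp [hp], hne⟩
  have hQ : 2 * #(F.image Prod.snd) ≤ #F := by
    refine mul_card_image_le_card F 2 fun a ha => ?_
    obtain ⟨p, hp, rfl⟩ := mem_image.1 ha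
    obtain ⟨q, hq, hne, hqp⟩ := hcol p hp
    exact one_lt_card.2 ⟨q, by simp [hq, hqp], p, by simp [hp], hne⟩
  have hp₀P : p₀.1 ∈ F.image Prod.fst := mem_image_of_mem _ hp₀
  have hPpos : 0 < #(F.image Prod.fst) := card_pos.2 ⟨_, hp₀P⟩
  -- The equation of row `p₀.1` is left out, as it follows from the other rows and the columns. By
  -- `hP` and `hQ` this leaves fewer equations than unknowns.
  let Φ : (ι × κ → ℝ) →ₗ[ℝ]
      ({x // x ∈ Fᶜ} ⊕ {x // x ∈ (F.image Prod.fst).erase p₀.1} ⊕ {x // x ∈ F.image Prod.snd} → ℝ) :=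
    LinearMap.pi (Sum.elim (fun p => LinearMap.proj p.1)
      (Sum.elim (fun i => ∑ j, LinearMap.proj (i.1, j)) (fun j => ∑ i, LinearMap.proj (i, j.1))))
  have hker : LinearMap.ker Φ ≠ ⊥ := by
    refine LinearMap.ker_ne_bot_of_finrank_lt ?_
    simp only [Module.finrank_fintype_fun_eq_card, Fintype.card_sum, Fintype.card_coe]
    have h1 := F.card_add_card_compl
    have h2 := card_erase_of_mem hp₀P
    omega
  obtain ⟨z, hz, hz0⟩ := (Submodule.ne_bot_iff _).1 hker
  have hz' : Φ z = 0 := hz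
  have hoff : ∀ p ∉ F, z p = 0 := fun p hp => by
    simpa [Φ] using congrFun hz' (.inl ⟨p, by simpa using hp⟩)
  have hcols : ∀ j, ∑ i, z (i, j) = 0 := fun j => by
    by_cases hj : j ∈ F.image Prod.snd
    · simpa [Φ] using congrFun hz' (.inr (.inr ⟨j, hj⟩))
    · exact sum_eq_zero fun i _ => hoff _ fun h => hj (mem_image_of_mem Prod.snd h)
  have hrows : ∀ i, i ≠ p₀.1 → ∑ j, z (i, j) = 0 := fun i hi => by
    by_cases hi' : i ∈ F.image Prod.fst
    · simpa [Φ] using congrFun hz' (.inr (.inl ⟨i, mem_erase.2 ⟨hi, hi'⟩⟩))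
    · exact sum_eq_zero fun j _ => hoff _ fun h => hi' (mem_image_of_mem Prod.fst h)
  refine ⟨z, hz0, hoff, fun i => ?_, hcols⟩
  by_cases hi : i = p₀.1
  · have htot : ∑ i, ∑ j, z (i, j) = 0 := by rw [sum_comm]; simp [hcols]
    rwa [Fintype.sum_eq_single p₀.1 hrows, ← hi] at htot
  · exact hrows i hi

/-- If a finite sum of reals is an integer and some term is not, then another term is not. -/
theorem exists_ne_not_int_of_sum {ι : Type*} [Fintype ι] [DecidableEq ι] (f : ι → ℝ) (m : ℤ)
    (h : ∑ i, f i = m) (i : ι) (hi : ¬ ∃ z : ℤ, (z : ℝ) = f i) :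
    ∃ j, j ≠ i ∧ ¬ ∃ z : ℤ, (z : ℝ) = f j := by
  by_contra! hcon
  choose! g hg using hcon
  refine hi ⟨m - ∑ j ∈ univ.erase i, g j, ?_⟩
  rw [← add_sum_erase _ _ (mem_univ i)] at h
  push_cast
  rw [← h, sum_congr rfl fun j hj => hg j (ne_of_mem_erase hj)]
  ring

/-- A nonempty transportation polytope with integer bounds and integer margins contains an
integer point. -/
theorem exists_int_transportation {ι κ : Type*} [Fintype ι] [Fintype κ]
    (l u : ι → κ → ℤ) (R : ι → ℤ) (C : κ → ℤ) (x₀ : ι × κ → ℝ)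
    (hl : ∀ i j, (l i j : ℝ) ≤ x₀ (i, j)) (hu : ∀ i j, x₀ (i, j) ≤ u i j)
    (hR : ∀ i, ∑ j, x₀ (i, j) = R i) (hC : ∀ j, ∑ i, x₀ (i, j) = C j) :
    ∃ b : ι → κ → ℤ, (∀ i j, l i j ≤ b i j) ∧ (∀ i j, b i j ≤ u i j) ∧
      (∀ i, ∑ j, b i j = R i) ∧ ∀ j, ∑ i, b i j = C j := by
  classical
  set K : Set (ι × κ → ℝ) := {x | x ∈ Set.Icc (fun p => (l p.1 p.2 : ℝ)) (fun p => (u p.1 p.2 : ℝ)) ∧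
    (∀ i, ∑ j, x (i, j) = R i) ∧ ∀ j, ∑ i, x (i, j) = C j} with hK
  have hKc : IsCompact K := by
    have h1 : IsClosed {x : ι × κ → ℝ | ∀ i, ∑ j, x (i, j) = R i} := by
      rw [Set.ofPred_forall]
      exact isClosed_iInter fun _ => isClosed_eq (by fun_prop) continuous_const
    have h2 : IsClosed {x : ι × κ → ℝ | ∀ j, ∑ i, x (i, j) = C j} := by
      rw [Set.ofPred_forall]
      exact isClosed_iInter fun _ => isClosed_eq (by fun_prop) continuous_const
    exact isCompact_Icc.inter_right (h1.inter h2)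
  obtain ⟨x, hx⟩ := hKc.extremePoints_nonempty ⟨x₀, ⟨fun p => hl _ _, fun p => hu _ _⟩, hR, hC⟩
  obtain ⟨⟨⟨hxl, hxu⟩, hxR, hxC⟩, hext⟩ := mem_extremePoints.1 hx
  set F : Finset (ι × κ) := univ.filter fun p => ¬ ∃ z : ℤ, (z : ℝ) = x p with hF
  have hFe : F = ∅ := by
    by_contra hne
    have hmem : ∀ p, p ∈ F ↔ ¬ ∃ z : ℤ, (z : ℝ) = x p := fun p => by simp [hF]
    obtain ⟨z, hz0, hz, hzR, hzC⟩ := exists_ne_zero_margins_zero F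
      (Finset.nonempty_iff_ne_empty.2 hne)
      (fun p hp => by
        obtain ⟨j, hj, hj'⟩ := exists_ne_not_int_of_sum (fun j => x (p.1, j)) _ (hxR p.1) p.2
          ((hmem p).1 hp)
        exact ⟨(p.1, j), (hmem _).2 hj', fun h => hj (congrArg Prod.snd h), rfl⟩)
      (fun p hp => by
        obtain ⟨i, hi, hi'⟩ := exists_ne_not_int_of_sum (fun i => x (i, p.2)) _ (hxC p.2) p.1
          ((hmem p).1 hp)
        exact ⟨(i, p.2), (hmem _).2 hi', fun h => hi (congrArg Prod.fst h), rfl⟩)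
    -- Non-integer entries lie strictly between their integer bounds, so `x` can move a little along
    -- `z` both ways. It is then the midpoint of two points of `K`, against extremality.
    have hev : ∀ᶠ ε : ℝ in nhds 0, ∀ p, (l p.1 p.2 : ℝ) ≤ x p + ε * z p ∧
        x p + ε * z p ≤ u p.1 p.2 := by
      refine Filter.eventually_all.2 fun p => ?_
      by_cases hp : p ∈ F
      · have hl' : (l p.1 p.2 : ℝ) < x p :=
          lt_of_le_of_ne (hxl p) fun h => (hmem p).1 hp ⟨_, h⟩
        have hu' : x p < (u p.1 p.2 : ℝ) :=
          lt_of_le_of_ne (hxu p) fun h => (hmem p).1 hp ⟨_, h.symm⟩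
        have ht : Filter.Tendsto (fun ε : ℝ => x p + ε * z p) (nhds 0) (nhds (x p)) := by
          have : Continuous fun ε : ℝ => x p + ε * z p := by fun_prop
          simpa using this.tendsto 0
        filter_upwards [ht.eventually_const_lt hl', ht.eventually_lt_const hu'] with ε h1 h2
        exact ⟨h1.le, h2.le⟩
      · simpa [hz p hp] using ⟨hxl p, hxu p⟩
    obtain ⟨δ, hδ, hball⟩ := Metric.eventually_nhds_iff.1 hev
    have hK' : ∀ ε : ℝ, |ε| < δ → x + ε • z ∈ K := fun ε hε => by
      have h := hball (y := ε) (by simpa using hε)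
      refine ⟨⟨fun p => (h p).1, fun p => (h p).2⟩, fun i => ?_, fun j => ?_⟩
      · simp [sum_add_distrib, ← mul_sum, hzR, hxR]
      · simp [sum_add_distrib, ← mul_sum, hzC, hxC]
    have hδ2 : |δ / 2| < δ := by rw [abs_of_pos (half_pos hδ)]; exact half_lt_self hδ
    have := hext _ (hK' (δ / 2) hδ2) _ (hK' (-(δ / 2)) (by rwa [abs_neg]))
      ⟨1 / 2, 1 / 2, by norm_num, by norm_num, by norm_num, by
        ext p; simp only [Pi.add_apply, Pi.smul_apply, smul_eq_mul]; ring⟩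
    have h0 : (δ / 2) • z = 0 := by simpa using this
    exact hz0 ((smul_eq_zero.1 h0).resolve_left (half_pos hδ).ne')
  have hint : ∀ p, ∃ z : ℤ, (z : ℝ) = x p := by
    intro p
    by_contra h
    have : p ∈ F := by simp only [hF, mem_filter, mem_univ, true_and]; exact h
    simp [hFe] at this
  choose b hb using hint
  refine ⟨fun i j => b (i, j), fun i j => ?_, fun i j => ?_, fun i => ?_, fun j => ?_⟩
  · have : (l i j : ℝ) ≤ x (i, j) := hxl (i, j)
    rw [← hb] at this
    exact_mod_cast this
  · have : x (i, j) ≤ (u i j : ℝ) := hxu (i, j)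
    rw [← hb] at this
    exact_mod_cast this
  · have := hxR i; simp only [← hb] at this; exact_mod_cast this
  · have := hxC j; simp only [← hb] at this; exact_mod_cast this

/-! ### Even division of an integer matrix -/

/-- A matrix whose entries, row sums and column sums are bounded by, respectively equal to,
`k` times those prescribed is a sum of `k` matrices with the prescribed data. -/
theorem exists_matrix_split {ι κ : Type*} [Fintype ι] [Fintype κ] (u : ι → κ → ℕ) (R : ι → ℕ)
    (C : κ → ℕ) (k : ℕ) (a : ι → κ → ℕ) (hu : ∀ i j, a i j ≤ k * u i j)
    (hR : ∀ i, ∑ j, a i j = k * R i) (hC : ∀ j, ∑ i, a i j = k * C j) :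
    ∃ b : Fin k → ι → κ → ℕ, (∀ c i j, b c i j ≤ u i j) ∧ (∀ i j, ∑ c, b c i j = a i j) ∧
      (∀ c i, ∑ j, b c i j = R i) ∧ ∀ c j, ∑ i, b c i j = C j := by
  induction k generalizing a with
  | zero =>
    refine ⟨fun c => c.elim0, fun c => c.elim0, fun i j => ?_, fun c => c.elim0, fun c => c.elim0⟩
    have := hu i j
    simp_all
  | succ k ih =>
    have hk : (0 : ℝ) < k + 1 := by positivity
    have hu' : ∀ i j, (a i j : ℝ) ≤ (k + 1) * u i j := fun i j => by exact_mod_cast hu i j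
    obtain ⟨b, hbl, hbu, hbR, hbC⟩ := exists_int_transportation
      -- The bound `a - k * u` keeps the remainder `a - b` at most `k * u`, as the induction needs;
      -- the bound `a` keeps it nonnegative.
      (fun i j => max 0 ((a i j : ℤ) - k * u i j)) (fun i j => min (u i j) (a i j))
      (fun i => (R i : ℤ)) (fun j => (C j : ℤ)) (fun p => (a p.1 p.2 : ℝ) / (k + 1))
      (fun i j => by
        have := hu' i j
        have h0 : (0 : ℝ) ≤ a i j := by positivity
        have hk0 : (0 : ℝ) ≤ k := by positivity
        push_cast
        refine max_le (by positivity) ?_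
        rw [le_div_iff₀ hk]
        nlinarith)
      (fun i j => by
        have := hu' i j
        have h0 : (0 : ℝ) ≤ a i j := by positivity
        have hk0 : (0 : ℝ) ≤ k := by positivity
        push_cast
        refine le_min ?_ ?_ <;> rw [div_le_iff₀ hk] <;> nlinarith)
      (fun i => by
        rw [← Finset.sum_div, div_eq_iff hk.ne']
        have := hR i
        rify at this
        push_cast
        linarith)
      (fun j => by
        rw [← Finset.sum_div, div_eq_iff hk.ne']
        have := hC j
        rify at this
        push_cast
        linarith)
    have hb0 : ∀ i j, 0 ≤ b i j := fun i j => (le_max_left _ _).trans (hbl i j)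
    have hb1 : ∀ i j, (a i j : ℤ) - k * u i j ≤ b i j := fun i j => (le_max_right _ _).trans (hbl i j)
    have hb2 : ∀ i j, b i j ≤ u i j := fun i j => (hbu i j).trans (min_le_left _ _)
    have hb3 : ∀ i j, b i j ≤ a i j := fun i j => (hbu i j).trans (min_le_right _ _)
    lift b to ι → κ → ℕ using hb0
    beta_reduce at hb1 hb2 hb3 hbR hbC
    norm_cast at hb2 hb3 hbR hbC
    have hsub : ∀ i j, a i j - b i j + b i j = a i j := fun i j => Nat.sub_add_cancel (hb3 i j)
    obtain ⟨B, hB1, hB2, hB3, hB4⟩ := ih (fun i j => a i j - b i j)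
      (fun i j => by
        have h1 := hb1 i j
        rw [tsub_le_iff_right]
        zify
        linarith)
      (fun i => by
        have h : ∑ j, (a i j - b i j) + ∑ j, b i j = ∑ j, a i j := by
          rw [← Finset.sum_add_distrib]; simp only [hsub]
        rw [hR, hbR] at h
        linarith)
      (fun j => by
        have h : ∑ i, (a i j - b i j) + ∑ i, b i j = ∑ i, a i j := by
          rw [← Finset.sum_add_distrib]; simp only [hsub]
        rw [hC, hbC] at h
        linarith)
    refine ⟨Fin.cons b B, fun c => ?_, fun i j => ?_, fun c => ?_, fun c => ?_⟩
    · refine Fin.cases ?_ (fun c => ?_) c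
      · simpa using hb2
      · simpa using hB1 c
    · rw [Fin.sum_univ_succ]
      simp only [Fin.cons_zero, Fin.cons_succ, hB2]
      have := hsub i j
      omega
    · refine Fin.cases ?_ (fun c => ?_) c
      · simpa using hbR
      · simpa using hB3 c
    · refine Fin.cases ?_ (fun c => ?_) c
      · simpa using hbC
      · simpa using hB4 c

/-! ### Undoing the amalgamation -/

/-- Extension of a three-dimensional zero-one array to one all of whose line sums are `lam`. -/
theorem exists_cube_extension {n lam r s p q : ℕ} (hp : r + p = n) (hq : s + q = n)
    (A : Fin r → Fin s → Fin n → ℕ) (hA1 : ∀ i j ℓ, A i j ℓ ≤ 1) (hA : ∀ i j, ∑ ℓ, A i j ℓ = lam)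
    (hrow : ∀ i ℓ, ∑ j, A i j ℓ ≤ lam) (hcol : ∀ j ℓ, ∑ i, A i j ℓ ≤ lam)
    (hlow : ∀ ℓ, lam * (r + s) ≤ lam * n + ∑ i, ∑ j, A i j ℓ)
    (hup : ∀ ℓ, lam * n + ∑ i, ∑ j, A i j ℓ ≤ lam * (r + s) + p * q)
    (hrow' : ∀ i ℓ, lam ≤ ∑ j, A i j ℓ + q) (hcol' : ∀ j ℓ, lam ≤ ∑ i, A i j ℓ + p) :
    ∃ B : Fin r ⊕ Fin p → Fin s ⊕ Fin q → Fin n → ℕ, (∀ i j ℓ, B i j ℓ ≤ 1) ∧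
      (∀ i j, B (.inl i) (.inl j) = A i j) ∧ (∀ i j, ∑ ℓ, B i j ℓ = lam) ∧
      (∀ i ℓ, ∑ j, B i j ℓ = lam) ∧ ∀ j ℓ, ∑ i, B i j ℓ = lam := by
  have hAr : ∀ i, ∑ ℓ, ∑ j, A i j ℓ = s * lam := fun i => by
    rw [Finset.sum_comm]; simp [hA]
  have hAc : ∀ j, ∑ ℓ, ∑ i, A i j ℓ = r * lam := fun j => by
    rw [Finset.sum_comm]; simp [hA]
  have hAt : ∑ ℓ, ∑ i, ∑ j, A i j ℓ = r * (s * lam) := by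
    rw [Finset.sum_comm]; simp [hAr]
  have hd1 : ∀ i ℓ, lam - ∑ j, A i j ℓ + ∑ j, A i j ℓ = lam := fun i ℓ => Nat.sub_add_cancel (hrow i ℓ)
  have hd2 : ∀ j ℓ, lam - ∑ i, A i j ℓ + ∑ i, A i j ℓ = lam := fun j ℓ => Nat.sub_add_cancel (hcol j ℓ)
  have hd3 : ∀ ℓ, (lam * n + ∑ i, ∑ j, A i j ℓ - lam * (r + s)) + lam * (r + s)
      = lam * n + ∑ i, ∑ j, A i j ℓ := fun ℓ => Nat.sub_add_cancel (hlow ℓ)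
  -- One piece per new column. The index `none` is the merged new row, standing for `p` cells, hence
  -- its entry bound `p` and row sum `lam * p`.
  obtain ⟨B, hB1, hB2, hB3, hB4⟩ := exists_matrix_split (ι := Option (Fin r)) (κ := Fin n)
    (fun i _ => i.elim p fun _ => 1) (fun i => i.elim (lam * p) fun _ => lam) (fun _ => lam) q
    (fun i ℓ => i.elim (lam * n + ∑ i, ∑ j, A i j ℓ - lam * (r + s)) fun i => lam - ∑ j, A i j ℓ)
    (by
      rintro (_ | i) ℓ
      · have := hup ℓ
        simp only [Option.elim]
        rw [tsub_le_iff_right]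
        linarith
      · have := hrow' i ℓ
        simp only [Option.elim]
        omega)
    (by
      rintro (_ | i)
      -- Over all symbols the corner holds `lam * (n² + r * s - (r + s) * n) = lam * p * q`.
      · have := Finset.sum_congr (s₁ := univ) rfl fun ℓ _ => hd3 ℓ
        rw [Finset.sum_add_distrib, Finset.sum_add_distrib, hAt] at this
        simp only [Finset.sum_const, Finset.card_univ, Fintype.card_fin, smul_eq_mul] at this
        simp only [Option.elim]
        generalize ∑ ℓ, (lam * n + ∑ i, ∑ j, A i j ℓ - lam * (r + s)) = t at this ⊢
        clear * - this hp hq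
        zify at this hp hq ⊢
        obtain hp : (p : ℤ) = n - r := by linarith
        obtain hq : (q : ℤ) = n - s := by linarith
        rw [hp, hq]
        linear_combination this
      · have := Finset.sum_congr (s₁ := univ) rfl fun ℓ _ => hd1 i ℓ
        rw [Finset.sum_add_distrib, hAr] at this
        simp only [Finset.sum_const, Finset.card_univ, Fintype.card_fin, smul_eq_mul] at this
        simp only [Option.elim]
        have h : n * lam = (s + q) * lam := by rw [hq]
        linarith)
    (by
      intro ℓ
      have := Finset.sum_congr (s₁ := univ) rfl fun i _ => hd1 i ℓ
      rw [Finset.sum_add_distrib] at this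
      simp only [Finset.sum_const, Finset.card_univ, Fintype.card_fin, smul_eq_mul] at this
      have h3 := hd3 ℓ
      rw [Fintype.sum_option]
      simp only [Option.elim]
      have : lam * n = lam * (s + q) := by rw [hq]
      linarith)
  -- One piece per new row. The matrix is now indexed by all columns, old and new; a new column `c`
  -- contributes its merged cell `B c none`.
  obtain ⟨D, hD1, hD2, hD3, hD4⟩ := exists_matrix_split (ι := Fin s ⊕ Fin q) (κ := Fin n)
    (fun _ _ => 1) (fun _ => lam) (fun _ => lam) p
    (Sum.elim (fun j ℓ => lam - ∑ i, A i j ℓ) (fun c => B c none))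
    (by
      rintro (j | c) ℓ
      · have := hcol' j ℓ
        simp only [Sum.elim_inl]
        omega
      · have := hB1 c none ℓ
        simpa using this)
    (by
      rintro (j | c)
      · have := Finset.sum_congr (s₁ := univ) rfl fun ℓ _ => hd2 j ℓ
        rw [Finset.sum_add_distrib, hAc] at this
        simp only [Finset.sum_const, Finset.card_univ, Fintype.card_fin, smul_eq_mul] at this
        simp only [Sum.elim_inl]
        have h : n * lam = (r + p) * lam := by rw [hp]
        linarith
      · simpa [mul_comm] using hB3 c none)
    (by
      intro ℓ
      have := Finset.sum_congr (s₁ := univ) rfl fun j _ => hd2 j ℓ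
      rw [Finset.sum_add_distrib, Finset.sum_comm (f := fun j i => A i j ℓ)] at this
      simp only [Finset.sum_const, Finset.card_univ, Fintype.card_fin, smul_eq_mul] at this
      have h3 := hd3 ℓ
      rw [Fintype.sum_sum_type]
      simp only [Sum.elim_inl, Sum.elim_inr, hB2, Option.elim]
      have : lam * n = lam * (r + p) := by rw [hp]
      linarith)
  refine ⟨Sum.elim (fun i => Sum.elim (A i) fun c => B c (some i)) D, ?_, fun i j => rfl, ?_, ?_, ?_⟩
  · rintro (i | d) (j | c) ℓ
    · exact hA1 i j ℓ
    · exact hB1 c (some i) ℓ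
    · exact hD1 d _ ℓ
    · exact hD1 d _ ℓ
  · rintro (i | d) (j | c)
    · exact hA i j
    · exact hB3 c (some i)
    · exact hD3 d _
    · exact hD3 d _
  · rintro (i | d) ℓ
    · have h1 := hB2 (some i) ℓ
      have h2 := hd1 i ℓ
      simp only [Option.elim] at h1
      simp only [Fintype.sum_sum_type, Sum.elim_inl, Sum.elim_inr]
      omega
    · exact hD4 d ℓ
  · rintro (j | c) ℓ
    · have h1 := hD2 (.inl j) ℓ
      have h2 := hd2 j ℓ
      simp only [Sum.elim_inl] at h1
      simp only [Fintype.sum_sum_type, Sum.elim_inl, Sum.elim_inr]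
      omega
    · have h1 := hD2 (.inr c) ℓ
      have h2 := hB4 c ℓ
      rw [Fintype.sum_option] at h2
      simp only [Sum.elim_inr] at h1
      simp only [Fintype.sum_sum_type, Sum.elim_inl, Sum.elim_inr]
      omega

/-! ### Latin squares and incidence arrays -/

namespace MultiArray

variable {r s k n lam : ℕ}

theorem sum_cellCount (M : MultiArray r s k) (i : Fin r) (j : Fin s) :
    ∑ ℓ, M.cellCount i j ℓ = (M i j).card :=
  Multiset.sum_count_eq_card fun _ _ => mem_univ _

/-- The `n` row counts of `ℓ` are each at most `lam` and add up to `lam * n`, so none falls short.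
-/
theorem IsLatinSquare.rowCount_eq {N : MultiArray n n n} (h : N.IsLatinSquare lam) (i ℓ : Fin n) :
    N.rowCount i ℓ = lam := by
  have hsum : ∑ i, N.rowCount i ℓ = ∑ _i : Fin n, lam := by
    rw [sum_const, card_univ, Fintype.card_fin, smul_eq_mul, mul_comm]
    exact h.symbolCount_eq ℓ
  exact (sum_eq_sum_iff_of_le fun i _ => h.rowCount_le i ℓ).1 hsum i (mem_univ i)

theorem IsLatinSquare.colCount_eq {N : MultiArray n n n} (h : N.IsLatinSquare lam) (j ℓ : Fin n) :
    N.colCount j ℓ = lam := by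
  have hsum : ∑ j, N.colCount j ℓ = ∑ _j : Fin n, lam := by
    have := h.symbolCount_eq ℓ
    rw [symbolCount, sum_comm] at this
    rw [sum_const, card_univ, Fintype.card_fin, smul_eq_mul, mul_comm]
    exact this
  exact (sum_eq_sum_iff_of_le fun j _ => h.colCount_le j ℓ).1 hsum j (mem_univ j)

end MultiArray

/-- The identification of `Fin r ⊕ Fin (n - r)` with `Fin n`, initial segment first. -/
def finSplit {r n : ℕ} (h : r ≤ n) : Fin r ⊕ Fin (n - r) ≃ Fin n :=
  finSumFinEquiv.trans (finCongr (Nat.add_sub_cancel' h))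

@[simp]
theorem finSplit_inl {r n : ℕ} (h : r ≤ n) (i : Fin r) : finSplit h (.inl i) = Fin.castLE h i :=
  rfl

theorem sum_fin_split {r n : ℕ} (h : r ≤ n) (f : Fin n → ℕ) :
    ∑ i, f i = ∑ i, f (Fin.castLE h i) + ∑ i, f (finSplit h (.inr i)) := by
  rw [← (finSplit h).sum_comp, Fintype.sum_sum_type]
  rfl

namespace MultiArray

variable {r s n lam : ℕ}

theorem IsLatinSquare.le_order {N : MultiArray n n n} (h : N.IsLatinSquare lam) (hN : N.IsSimple)
    (hn : 1 ≤ n) : lam ≤ n := by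
  have h1 := N.sum_cellCount ⟨0, hn⟩ ⟨0, hn⟩
  rw [h.isLamMatrix] at h1
  calc lam = ∑ ℓ, N.cellCount ⟨0, hn⟩ ⟨0, hn⟩ ℓ := h1.symm
    _ ≤ ∑ _ℓ : Fin n, 1 := sum_le_sum fun ℓ _ => hN _ _ ℓ
    _ = n := by simp

/-- A simple Latin square from its zero-one incidence array. -/
theorem exists_isLatinSquare_extends (hr : r ≤ n) (hs : s ≤ n) (M : MultiArray r s n)
    (B : Fin n → Fin n → Fin n → ℕ) (hB : ∀ i j ℓ, B i j ℓ ≤ 1)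
    (hM : ∀ i j, B (Fin.castLE hr i) (Fin.castLE hs j) = M.cellCount i j)
    (hcell : ∀ i j, ∑ ℓ, B i j ℓ = lam) (hrow : ∀ i ℓ, ∑ j, B i j ℓ = lam)
    (hcol : ∀ j ℓ, ∑ i, B i j ℓ = lam) :
    ∃ N : MultiArray n n n, N.IsLatinSquare lam ∧ N.IsSimple ∧ N.Extends hr hs M := by
  let N : MultiArray n n n := fun i j => (univ.filter fun ℓ => B i j ℓ = 1).val
  have hN : ∀ i j ℓ, N.cellCount i j ℓ = B i j ℓ := fun i j ℓ => by
    have := hB i j ℓ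
    simp only [cellCount, N]
    rw [Multiset.count_eq_of_nodup (Finset.nodup _)]
    simp only [mem_val, mem_filter, mem_univ, true_and]
    split_ifs <;> omega
  refine ⟨N, ⟨fun i j => ?_, fun ℓ => ?_, fun i ℓ => ?_, fun j ℓ => ?_⟩, fun i j ℓ => ?_,
    fun i j => ?_⟩
  · rw [← sum_cellCount]
    simp [hN, hcell]
  · simp [symbolCount, hN, hrow, mul_comm]
  · simp [rowCount, hN, hrow]
  · simp [colCount, hN, hcol]
  · rw [hN]
    exact hB i j ℓ
  · ext ℓ
    exact (hN _ _ ℓ).trans (congrFun (hM i j) ℓ)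

end MultiArray

/-! ### The characterization -/

theorem mainTheorem4 (r s n lam : ℕ) (hn : 1 ≤ n) (hlam : 1 ≤ lam) (hr : r ≤ n) (hs : s ≤ n)
    (M : MultiArray r s n) (hM : M.IsLatinRectangle lam) (hMs : M.IsSimple) :
    (∃ N : MultiArray n n n, N.IsLatinSquare lam ∧ N.IsSimple ∧ N.Extends hr hs M) ↔
      (lam ≤ n ∧
        (∀ ℓ : Fin n,
          (lam : ℤ) * ((r : ℤ) + (s : ℤ) - (n : ℤ)) ≤ (M.symbolCount ℓ : ℤ) ∧
          (M.symbolCount ℓ : ℤ) ≤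
            (lam : ℤ) * ((r : ℤ) + (s : ℤ) - (n : ℤ)) +
              ((n : ℤ) - (r : ℤ)) * ((n : ℤ) - (s : ℤ))) ∧
        (∀ (i : Fin r) (ℓ : Fin n),
          (lam : ℤ) + (s : ℤ) - (n : ℤ) ≤ (M.rowCount i ℓ : ℤ)) ∧
        (∀ (j : Fin s) (ℓ : Fin n),
          (lam : ℤ) + (r : ℤ) - (n : ℤ) ≤ (M.colCount j ℓ : ℤ))) := by
  constructor
  · rintro ⟨N, hN, hNs, hE⟩
    have hc : ∀ i j ℓ, N.cellCount (Fin.castLE hr i) (Fin.castLE hs j) ℓ = M.cellCount i j ℓ :=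
      fun i j ℓ => congrArg (Multiset.count ℓ) (hE i j)
    have hrow : ∀ i ℓ, M.rowCount i ℓ +
        ∑ j, N.cellCount (Fin.castLE hr i) (finSplit hs (.inr j)) ℓ = lam := fun i ℓ => by
      rw [← hN.rowCount_eq (Fin.castLE hr i) ℓ, MultiArray.rowCount, MultiArray.rowCount,
        sum_fin_split hs]
      simp only [hc]
    have hcol : ∀ j ℓ, M.colCount j ℓ +
        ∑ i, N.cellCount (finSplit hr (.inr i)) (Fin.castLE hs j) ℓ = lam := fun j ℓ => by
      rw [← hN.colCount_eq (Fin.castLE hs j) ℓ, MultiArray.colCount, MultiArray.colCount,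
        sum_fin_split hr]
      simp only [hc]
    have hbound : ∀ {m : ℕ} (f : Fin m → ℕ), (∀ i, f i ≤ 1) → ∑ i, f i ≤ m := fun f hf =>
      (sum_le_sum fun i _ => hf i).trans (by simp)
    refine ⟨hN.le_order hNs hn, fun ℓ => ?_, fun i ℓ => ?_, fun j ℓ => ?_⟩
    -- `t` counts `ℓ` in the new corner. Eliminating the top right block between `h1` and `h2` gives
    -- `t = |M_ℓ| - lam(r+s-n)`, so both bounds on `|M_ℓ|` are `0 ≤ t ≤ (n-r)(n-s)`.
    · set t := ∑ j : Fin (n - s), ∑ i : Fin (n - r),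
        N.cellCount (finSplit hr (.inr i)) (finSplit hs (.inr j)) ℓ with ht
      have h1 := sum_congr (s₁ := univ) rfl fun i _ => hrow i ℓ
      have h2 := sum_congr (s₁ := univ) rfl fun j (_ : j ∈ univ) =>
        hN.colCount_eq (finSplit hs (.inr j)) ℓ
      simp only [MultiArray.colCount, sum_fin_split hr] at h2
      rw [sum_add_distrib] at h1 h2
      rw [sum_comm, ← ht] at h2
      simp only [sum_const, card_univ, Fintype.card_fin, smul_eq_mul] at h1 h2
      have h3 : t ≤ (n - s) * (n - r) := by
        refine (sum_le_sum fun j _ => hbound _ fun i => hNs _ _ ℓ).trans ?_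
        simp
      have h4 : M.symbolCount ℓ = ∑ i, M.rowCount i ℓ := rfl
      rw [← h4] at h1
      zify [hr, hs] at h1 h2 h3
      constructor <;> nlinarith
    · have h1 := hrow i ℓ
      have h2 := hbound _ fun j => hNs (Fin.castLE hr i) (finSplit hs (.inr j)) ℓ
      omega
    · have h1 := hcol j ℓ
      have h2 := hbound _ fun i => hNs (finSplit hr (.inr i)) (Fin.castLE hs j) ℓ
      omega
  · rintro ⟨-, hsym, hrow, hcol⟩
    obtain ⟨B, hB, hBM, hB1, hB2, hB3⟩ := exists_cube_extension (lam := lam)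
      (Nat.add_sub_cancel' hr) (Nat.add_sub_cancel' hs) M.cellCount hMs
      (fun i j => (M.sum_cellCount i j).trans (hM.isLamMatrix i j)) hM.rowCount_le hM.colCount_le
      (fun ℓ => by
        have := (hsym ℓ).1
        rw [MultiArray.symbolCount] at this
        zify at this ⊢
        linarith)
      (fun ℓ => by
        have := (hsym ℓ).2
        rw [MultiArray.symbolCount] at this
        zify [hr, hs] at this ⊢
        linarith)
      (fun i ℓ => by
        have := hrow i ℓ
        rw [MultiArray.rowCount] at this
        omega)
      (fun j ℓ => by
        have := hcol j ℓ
        rw [MultiArray.colCount] at this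
        omega)
    refine MultiArray.exists_isLatinSquare_extends hr hs M
      (fun i j => B ((finSplit hr).symm i) ((finSplit hs).symm j)) (fun i j ℓ => hB _ _ ℓ)
      (fun i j => ?_) (fun i j => hB1 _ _) (fun i ℓ => ?_) (fun j ℓ => ?_)
    · simp only [← finSplit_inl, Equiv.symm_apply_apply, hBM]
    · rw [(finSplit hs).symm.sum_comp fun j => B ((finSplit hr).symm i) j ℓ]
      exact hB2 _ ℓ
    · rw [(finSplit hr).symm.sum_comp fun i => B i ((finSplit hs).symm j) ℓ]
      exact hB3 _ ℓ
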